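/- Let $X$ be a real random variable, let $Z\sim N(0,1)$ with density $\varphi(x)=\frac1{\sqrt{2\pi}}e^{-x^2/2}$, and let $H_k(x)=(-1)^k\,\big(e^{-x^2/2}\big)^{(k)}e^{x^2/2}$, $k=0,1,2,\dots$, be the Chebyshev–Hermite polynomials. Put $$\chi^2(X,Z)=\int_{-\infty}^{\infty}\frac{(p(x)-\varphi(x))^2}{\varphi(x)}\,dx$$ if the distribution of $X$ is absolutely continuous with respect to Lebesgue measure, with density $p$, and $\chi^2(X,Z)=\infty$ otherwise. (a) Suppose that $\mathbb E|X|^k<\infty$ for all $k\in\mathbb N$. If the series $\sum_{k=1}^{\infty}\frac{1}{k!}\,(\mathbb E H_k(X))^2$ converges, then the distribution of $X$ is absolutely continuous with respect to Lebesgue measure, $\chi^2(X,Z)<\infty$, and $$\chi^2(X,Z)=\sum_{k=1}^{\infty}\frac{1}{k!}\,(\mathbb E H_k(X))^2 .$$ (b) Suppose that $X$ is bounded, i.e. there is a real $M$ such that $|X|\le M$ almost surely. Then $X$ has an absolutely continuous distribution with a density in $L^2(\mathbb R)$ if and only if the series $\sum_{k=1}^{\infty}\frac{1}{k!}\,(\mathbb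 E H_k(X))^2$ converges. -/

import Mathlib

open MeasureTheory ProbabilityTheory
open scoped ENNReal Nat

/-- The `k`-th normal moment `E H_k(X)`, where `H_k` is the Chebyshev-Hermite polynomial
`H_k(x) = (-1)^k (e^{-x^2/2})^{(k)} e^{x^2/2}` (Mathlib's probabilists' Hermite polynomial). -/
noncomputable def normalMoment {Ω : Type*} [MeasurableSpace Ω] (P : Measure Ω) (X : Ω → ℝ)
    (k : ℕ) : ℝ :=
  ∫ ω, (Polynomial.aeval (X ω) (Polynomial.hermite k) : ℝ) ∂P

open scoped Classical in
/-- The Pearson distance `χ²(X, Z) = ∫ (p - φ)² / φ dx` of a random variable `X` with law `ν`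
from a standard normal `Z`. Here `p` is the Lebesgue density of `ν` and `φ` the standard normal
density; the value is `∞` if `ν` is not absolutely continuous. -/
noncomputable def chiSqNormal (ν : Measure ℝ) : ℝ≥0∞ :=
  if ν ≪ volume then
    ∫⁻ x, ENNReal.ofReal
      (((ν.rnDeriv volume x).toReal - gaussianPDFReal 0 1 x) ^ 2 / gaussianPDFReal 0 1 x)
  else ∞

/-! Let γ be the standard normal law and ν the law of X. The H_k/√k! are orthonormal in L²(γ), and
if ν = g·γ then χ² = ‖g - 1‖² in L²(γ), so the series is a Parseval sum. For (a), Riesz–Fischer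
yields g in L²(γ) with the Hermite coefficients of ν, hence with equal power moments
(`exists_memLp_integral_hermiteReal_mul_eq`). The moments determine the law: g·γ has all exponential
moments by Cauchy–Schwarz, ν inherits them, and both Fourier transforms are the same power series in
the moments. Thus ν = g·γ (`eq_withDensity_gaussianReal_of_integral_pow_eq`). Completeness of the
Hermite system is not needed. For (b), φ ≥ φ(M) on [-M, M], so an L² density p makes p/φ lie in
L²(γ), and Bessel gives convergence; conversely (a) gives χ² < ∞, and φ ≤ 1 puts p - φ in L². -/

/-- The probabilists' Hermite polynomial with real coefficients. -/
noncomputable def hermiteReal (n : ℕ) : Polynomial ℝ :=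
  (Polynomial.hermite n).map (Int.castRingHom ℝ)

theorem eval_hermiteReal (n : ℕ) (x : ℝ) :
    (hermiteReal n).eval x = Polynomial.aeval x (Polynomial.hermite n) := by
  rw [hermiteReal, Polynomial.aeval_def, Polynomial.eval_map]
  rfl

theorem hermiteReal_zero : hermiteReal 0 = 1 := by
  simp [hermiteReal]

theorem hermiteReal_succ (n : ℕ) :
    hermiteReal (n + 1) =
      Polynomial.X * hermiteReal n - Polynomial.derivative (hermiteReal n) := by
  simp [hermiteReal, Polynomial.hermite_succ, Polynomial.derivative_map]

theorem hermiteReal_monic (n : ℕ) : (hermiteReal n).Monic :=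
  (Polynomial.hermite_monic n).map _

theorem natDegree_hermiteReal (n : ℕ) : (hermiteReal n).natDegree = n := by
  rw [hermiteReal, (Polynomial.hermite_monic n).natDegree_map, Polynomial.natDegree_hermite]

/-! ### Orthogonality of the Hermite polynomials under the normal law. -/

theorem memLp_pow_gaussianReal (n : ℕ) :
    MemLp (fun x : ℝ => x ^ n) 2 (gaussianReal 0 1) := by
  rw [memLp_two_iff_integrable_sq_norm (by fun_prop)]
  have h := (memLp_id_gaussianReal (μ := 0) (v := 1) ((2 * n : ℕ) : NNReal)).integrable_norm_pow'
  simpa [← pow_mul, mul_comm] using h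

theorem memLp_eval_gaussianReal (p : Polynomial ℝ) :
    MemLp (fun x : ℝ => p.eval x) 2 (gaussianReal 0 1) := by
  simp_rw [Polynomial.eval_eq_sum_range]
  exact memLp_finsetSum _ fun i _ => (memLp_pow_gaussianReal i).const_mul _

theorem integrable_eval_gaussianReal (p : Polynomial ℝ) :
    Integrable (fun x : ℝ => p.eval x) (gaussianReal 0 1) :=
  (memLp_eval_gaussianReal p).integrable (by norm_num)

theorem integrable_gaussianReal_iff {f : ℝ → ℝ} :
    Integrable f (gaussianReal 0 1) ↔ Integrable fun x => gaussianPDFReal 0 1 x * f x := by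
  rw [gaussianReal_of_var_ne_zero _ one_ne_zero,
    integrable_withDensity_iff_integrable_smul' (measurable_gaussianPDF 0 1)
      (by simp [gaussianPDF])]
  simp [toReal_gaussianPDF]

theorem hasDerivAt_gaussianPDFReal (x : ℝ) :
    HasDerivAt (gaussianPDFReal 0 1) (-x * gaussianPDFReal 0 1 x) x := by
  have h : HasDerivAt (fun y : ℝ => -(y - 0) ^ 2 / (2 * 1)) (-x) x := by
    exact ((((hasDerivAt_id' x).sub_const 0).fun_pow 2).fun_neg.div_const (2 * 1)).congr_deriv
      (by ring)
  simp only [gaussianPDFReal_def, NNReal.coe_one]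
  exact (h.exp.const_mul (Real.sqrt (2 * Real.pi * 1))⁻¹).congr_deriv (by ring)

/-- Stein's identity for polynomials. -/
theorem integral_X_mul_sub_derivative_gaussianReal (q : Polynomial ℝ) :
    ∫ x, (Polynomial.X * q - Polynomial.derivative q).eval x ∂(gaussianReal 0 1) = 0 := by
  rw [integral_gaussianReal_eq_integral_smul one_ne_zero]
  -- The integrand is, up to sign, the derivative of the integrable function φq.
  have key := integral_eq_zero_of_hasDerivAt_of_integrable
    (f := fun x => gaussianPDFReal 0 1 x * q.eval x)
    (f' := fun x => -(gaussianPDFReal 0 1 x *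
      (Polynomial.X * q - Polynomial.derivative q).eval x))
    (fun x => by
      refine ((hasDerivAt_gaussianPDFReal x).fun_mul (q.hasDerivAt x)).congr_deriv ?_
      simp only [Polynomial.eval_sub, Polynomial.eval_mul, Polynomial.eval_X]
      ring)
    (integrable_gaussianReal_iff.1 (integrable_eval_gaussianReal _)).neg
    (integrable_gaussianReal_iff.1 (integrable_eval_gaussianReal _))
  rw [integral_neg, neg_eq_zero] at key
  simpa using key

/-- Repeated integration by parts: H_{n+1} p - H_n p' = X q - q' with q = H_n p, so Stein's identity
moves one derivative onto p. -/
theorem integral_hermiteReal_mul (n : ℕ) (p : Polynomial ℝ) :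
    ∫ x, (hermiteReal n * p).eval x ∂(gaussianReal 0 1) =
      ∫ x, (Polynomial.derivative^[n] p).eval x ∂(gaussianReal 0 1) := by
  induction n generalizing p with
  | zero => simp [hermiteReal_zero]
  | succ n ih =>
    rw [Function.iterate_succ_apply, ← ih, ← sub_eq_zero,
      ← integral_sub (integrable_eval_gaussianReal _) (integrable_eval_gaussianReal _)]
    refine (integral_congr_ae (.of_forall fun x => ?_)).trans
      (integral_X_mul_sub_derivative_gaussianReal (hermiteReal n * p))
    simp [hermiteReal_succ]
    ring

theorem integral_hermiteReal_mul_hermiteReal (m n : ℕ) :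
    ∫ x, (hermiteReal m * hermiteReal n).eval x ∂(gaussianReal 0 1) =
      if m = n then (n ! : ℝ) else 0 := by
  wlog h : n ≤ m generalizing m n
  · rw [mul_comm, this n m (by omega), if_neg (by omega), if_neg (by omega)]
  rw [integral_hermiteReal_mul]
  rcases h.lt_or_eq with h | rfl
  · rw [Polynomial.iterate_derivative_eq_zero (by rwa [natDegree_hermiteReal]),
      if_neg h.ne']
    simp
  · have hd : (Polynomial.derivative^[n] (hermiteReal n)) = Polynomial.C (n ! : ℝ) := by
      rw [Polynomial.eq_C_of_natDegree_le_zero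
        (p := Polynomial.derivative^[n] (hermiteReal n))
        ((Polynomial.natDegree_iterate_derivative _ _).trans (by simp [natDegree_hermiteReal])),
        Polynomial.coeff_iterate_derivative]
      have := (hermiteReal_monic n).coeff_natDegree
      rw [natDegree_hermiteReal] at this
      simp [this, Nat.descFactorial_self]
    simp [hd]

/-- The `n`-th Hermite polynomial, normalized in `L²` of the standard normal law. -/
noncomputable def hermiteLp (n : ℕ) : Lp ℝ 2 (gaussianReal 0 1) :=
  (√(n ! : ℝ))⁻¹ • (memLp_eval_gaussianReal (hermiteReal n)).toLp

theorem inner_hermiteLp {g : ℝ → ℝ} (hg : MemLp g 2 (gaussianReal 0 1)) (n : ℕ) :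
    inner ℝ (hermiteLp n) hg.toLp =
      (√(n ! : ℝ))⁻¹ * ∫ x, (hermiteReal n).eval x * g x ∂(gaussianReal 0 1) := by
  rw [hermiteLp, real_inner_smul_left, L2.inner_def]
  congr 1
  refine integral_congr_ae ?_
  filter_upwards [hg.coeFn_toLp, (memLp_eval_gaussianReal (hermiteReal n)).coeFn_toLp]
    with x h1 h2
  simp [h1, h2, mul_comm]

theorem orthonormal_hermiteLp : Orthonormal ℝ hermiteLp := by
  rw [orthonormal_iff_ite]
  intro m n
  nth_rewrite 2 [hermiteLp]
  rw [real_inner_smul_right, inner_hermiteLp]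
  have h := integral_hermiteReal_mul_hermiteReal m n
  simp only [Polynomial.eval_mul] at h
  rw [h]
  split_ifs with hmn
  · subst hmn
    have : (0 : ℝ) < m ! := by positivity
    rw [← mul_assoc, ← mul_inv, Real.mul_self_sqrt this.le, inv_mul_cancel₀ this.ne']
  · simp

/-- A functional on polynomials is determined by its values on Hermite polynomials. -/
theorem linearMap_ext_hermiteReal {L₁ L₂ : Polynomial ℝ →ₗ[ℝ] ℝ}
    (h : ∀ n, L₁ (hermiteReal n) = L₂ (hermiteReal n)) : L₁ = L₂ := by
  have key : ∀ n : ℕ, ∀ p : Polynomial ℝ, p.degree < n → L₁ p = L₂ p := by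
    intro n
    induction n with
    | zero =>
      intro p hp
      have : p = 0 := by simpa using hp
      simp [this]
    | succ n ih =>
      intro p hp
      -- H_n is monic of degree n, so this cancels the leading term.
      have hq : (p - p.coeff n • hermiteReal n).degree < n := by
        rw [Polynomial.degree_lt_iff_coeff_zero] at hp ⊢
        intro m hm
        rcases hm.lt_or_eq with hm | rfl
        · rw [Polynomial.coeff_sub, Polynomial.coeff_smul, hp m (by exact_mod_cast hm),
            Polynomial.coeff_eq_zero_of_natDegree_lt (p := hermiteReal n)
              (by rwa [natDegree_hermiteReal])]
          simp
        · have := (hermiteReal_monic n).coeff_natDegree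
          rw [natDegree_hermiteReal] at this
          simp [this]
      have h1 := ih _ hq
      rw [map_sub, map_sub, map_smul, map_smul, h n] at h1
      linarith
  ext n
  exact key (n + 1) _ ((Polynomial.degree_monomial_le n _).trans_lt (by exact_mod_cast n.lt_succ_self))

/-! ### Riesz–Fischer and passage to power moments. -/

theorem HasSum.congr_left {ι E : Type*} [AddCommMonoid E] [TopologicalSpace E] {f g : ι → E}
    {a : E} (hg : HasSum g a) (h : ∀ i, f i = g i) : HasSum f a := by
  rwa [funext h]

theorem Orthonormal.exists_hasSum_smul {ι E : Type*} [NormedAddCommGroup E]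
    [InnerProductSpace ℝ E] [CompleteSpace E] {v : ι → E} (hv : Orthonormal ℝ v) {a : ι → ℝ}
    (ha : Summable fun i => a i ^ 2) :
    ∃ g : E, HasSum (fun i => a i • v i) g ∧ ‖g‖ ^ 2 = ∑' i, a i ^ 2 := by
  have hmem : Memℓp a 2 := memℓp_gen (by simpa using ha)
  let f : lp (fun _ : ι => ℝ) 2 := ⟨a, hmem⟩
  refine ⟨hv.orthogonalFamily.linearIsometry f, ?_, ?_⟩
  · simpa [f] using hv.orthogonalFamily.hasSum_linearIsometry f
  · rw [LinearIsometry.norm_map]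
    have := lp.norm_rpow_eq_tsum (p := 2) (by norm_num) f
    simpa [f] using this

/-- The Riesz–Fischer theorem for Hermite expansions with constant term `1`. -/
theorem exists_memLp_integral_hermiteReal_mul_eq {m : ℕ → ℝ} (hm0 : m 0 = 1)
    (hm : Summable fun k => m (k + 1) ^ 2 / ((k + 1)! : ℝ)) :
    ∃ g : ℝ → ℝ, Measurable g ∧ MemLp g 2 (gaussianReal 0 1) ∧
      (∀ n, ∫ x, (hermiteReal n).eval x * g x ∂(gaussianReal 0 1) = m n) ∧
      ∫ x, (g x - 1) ^ 2 ∂(gaussianReal 0 1) = ∑' k, m (k + 1) ^ 2 / ((k + 1)! : ℝ) := by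
  have hsq : ∀ k, ((√((k + 1)! : ℝ))⁻¹ * m (k + 1)) ^ 2 = m (k + 1) ^ 2 / ((k + 1)! : ℝ) := by
    intro k
    rw [mul_pow, inv_pow, Real.sq_sqrt (by positivity), inv_mul_eq_div]
  -- Only indices ≥ 1 enter: G represents g - 1, and the constant 1 is added back at the end.
  have hortho : Orthonormal ℝ fun k => hermiteLp (k + 1) :=
    orthonormal_hermiteLp.comp _ (add_left_injective 1)
  obtain ⟨G, hG, hnorm⟩ := hortho.exists_hasSum_smul (a := fun k => (√((k + 1)! : ℝ))⁻¹ * m (k + 1))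
    (by simpa only [hsq] using hm)
  simp only [hsq] at hnorm
  have hinner0 : inner ℝ (hermiteLp 0) G = 0 := by
    refine (hG.mapL (innerSL ℝ (hermiteLp 0))).unique
      (hasSum_zero.congr_left fun k => ?_)
    simp [orthonormal_hermiteLp.inner_eq_zero (Nat.succ_ne_zero k).symm]
  have hinner : ∀ n, inner ℝ (hermiteLp (n + 1)) G = (√((n + 1)! : ℝ))⁻¹ * m (n + 1) := by
    intro n
    refine (hG.mapL (innerSL ℝ (hermiteLp (n + 1)))).unique
      ((hasSum_ite_eq n ((√((n + 1)! : ℝ))⁻¹ * m (n + 1))).congr_left fun k => ?_)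
    have := orthonormal_iff_ite.1 orthonormal_hermiteLp (n + 1) (k + 1)
    simp only [innerSL_apply_apply, real_inner_smul_right, this]
    by_cases h : k = n
    · subst h; simp
    · simp [h, Ne.symm h]
  obtain ⟨u, hu, huG⟩ := (Lp.aestronglyMeasurable G).aemeasurable
  have huL : MemLp u 2 (gaussianReal 0 1) := (memLp_congr_ae huG).1 (Lp.memLp G)
  have hGu : huL.toLp = G := by
    rw [← Lp.toLp_coeFn G (Lp.memLp G)]
    exact (MemLp.toLp_eq_toLp_iff _ _).2 huG.symm
  have hsub : ∀ n, ∫ x, (hermiteReal n).eval x * (u x + 1) ∂(gaussianReal 0 1) =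
      (∫ x, (hermiteReal n).eval x * u x ∂(gaussianReal 0 1)) + if n = 0 then 1 else 0 := by
    intro n
    have h0 := integral_hermiteReal_mul_hermiteReal n 0
    rw [hermiteReal_zero, mul_one, Nat.factorial_zero, Nat.cast_one] at h0
    simp only [mul_add, mul_one]
    rw [← h0]
    exact integral_add ((memLp_eval_gaussianReal _).integrable_mul huL)
      (integrable_eval_gaussianReal _)
  refine ⟨fun x => u x + 1, hu.add_const 1, huL.add (memLp_const 1), ?_, ?_⟩
  · rintro (_ | n)
    · rw [hsub, if_pos rfl, hm0, add_eq_right]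
      rw [← hGu, inner_hermiteLp] at hinner0
      simpa using hinner0
    · rw [hsub, if_neg (Nat.succ_ne_zero n), add_zero]
      have := hinner n
      rw [← hGu, inner_hermiteLp] at this
      exact mul_left_cancel₀ (by positivity) this
  · rw [← hnorm, ← hGu, ← real_inner_self_eq_norm_sq, L2.inner_def]
    refine integral_congr_ae ?_
    filter_upwards [huL.coeFn_toLp] with x hx
    simp [hx, sq]

theorem Polynomial.integrable_eval_mul {μ : Measure ℝ} {w : ℝ → ℝ}
    (h : ∀ n : ℕ, Integrable (fun x => x ^ n * w x) μ) (p : Polynomial ℝ) :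
    Integrable (fun x => p.eval x * w x) μ := by
  simp_rw [Polynomial.eval_eq_sum_range, Finset.sum_mul, mul_assoc]
  exact integrable_finsetSum _ fun i _ => (h i).const_mul _

/-- Weighted integrals with equal Hermite moments have equal power moments. -/
theorem integral_pow_mul_eq_of_integral_hermiteReal_mul_eq {μ ν : Measure ℝ} {w z : ℝ → ℝ}
    (hw : ∀ n : ℕ, Integrable (fun x => x ^ n * w x) μ)
    (hz : ∀ n : ℕ, Integrable (fun x => x ^ n * z x) ν)
    (h : ∀ n, ∫ x, (hermiteReal n).eval x * w x ∂μ = ∫ x, (hermiteReal n).eval x * z x ∂ν)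
    (n : ℕ) : ∫ x, x ^ n * w x ∂μ = ∫ x, x ^ n * z x ∂ν := by
  let L : ∀ (μ : Measure ℝ) (w : ℝ → ℝ), (∀ n : ℕ, Integrable (fun x => x ^ n * w x) μ) →
      Polynomial ℝ →ₗ[ℝ] ℝ := fun μ w hw =>
    { toFun := fun p => ∫ x, p.eval x * w x ∂μ
      map_add' := fun p q => by
        simp only [Polynomial.eval_add, add_mul]
        exact integral_add (Polynomial.integrable_eval_mul hw p)
          (Polynomial.integrable_eval_mul hw q)
      map_smul' := fun c p => by
        simp only [Polynomial.eval_smul, smul_eq_mul, mul_assoc, integral_const_mul,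
          RingHom.id_apply] }
  have := LinearMap.congr_fun (linearMap_ext_hermiteReal (L₁ := L μ w hw) (L₂ := L ν z hz) h)
    (Polynomial.X ^ n)
  simpa [L] using this

/-! ### Determination of the law by its moments. -/

theorem hasSum_integral_pow_div_factorial_mul {μ : Measure ℝ} {w : ℝ → ℝ} (hwm : Measurable w)
    (z : ℂ) (hw : Integrable (fun x => Real.exp (‖z‖ * |x|) * w x) μ) :
    HasSum (fun k : ℕ => z ^ k / (k ! : ℂ) * ((∫ x, x ^ k * w x ∂μ : ℝ) : ℂ))
      (∫ x, Complex.exp (z * x) * w x ∂μ) := by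
  have hexp : ∀ r : ℝ, HasSum (fun k : ℕ => r ^ k / (k ! : ℝ)) (Real.exp r) := fun r => by
    rw [Real.exp_eq_exp_ℝ]; exact NormedSpace.expSeries_div_hasSum_exp r
  have hcexp : ∀ r : ℂ, HasSum (fun k : ℕ => r ^ k / (k ! : ℂ)) (Complex.exp r) := fun r => by
    rw [Complex.exp_eq_exp_ℂ]; exact NormedSpace.expSeries_div_hasSum_exp r
  have hbound : ∀ x, HasSum (fun k : ℕ => (‖z‖ * |x|) ^ k / (k ! : ℝ) * |w x|)
      (Real.exp (‖z‖ * |x|) * |w x|) := fun x => (hexp _).mul_right _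
  have key := hasSum_integral_of_dominated_convergence (μ := μ)
    (F := fun (k : ℕ) x => (z * x) ^ k / (k ! : ℂ) * (w x : ℂ))
    (f := fun x => Complex.exp (z * x) * w x)
    (fun k x => (‖z‖ * |x|) ^ k / (k ! : ℝ) * |w x|)
    (fun k => by
      refine Measurable.aestronglyMeasurable ?_
      fun_prop)
    (fun k => .of_forall fun x => by simp)
    (.of_forall fun x => (hbound x).summable)
    (by
      simp only [fun x => (hbound x).tsum_eq]
      simpa [abs_mul] using hw.norm)
    (.of_forall fun x => (hcexp _).mul_right _)
  refine key.congr_left fun k => ?_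
  rw [← integral_complex_ofReal, ← integral_const_mul]
  refine integral_congr_ae (.of_forall fun x => ?_)
  push_cast
  ring

theorem integrable_exp_mul_abs_mul_gaussianReal {g : ℝ → ℝ} (hg : MemLp g 2 (gaussianReal 0 1))
    (t : ℝ) : Integrable (fun x => Real.exp (t * |x|) * g x) (gaussianReal 0 1) := by
  refine MemLp.integrable_mul (p := 2) (q := 2) ?_ hg
  rw [memLp_two_iff_integrable_sq (by fun_prop)]
  have := integrable_exp_mul_abs (X := id) (integrable_exp_mul_gaussianReal (μ := 0) (v := 1) (2 * t))
    (integrable_exp_mul_gaussianReal (-(2 * t)))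
  simpa [← Real.exp_nat_mul, mul_assoc] using this

/-- If the power moments of `ν` are those of a weighted law `w • μ` with all exponential
moments, then `ν` has all exponential moments. -/
theorem integrable_exp_mul_abs_of_integral_pow_eq {μ ν : Measure ℝ}
    {w : ℝ → ℝ} (hwm : Measurable w)
    (hw : ∀ t, Integrable (fun x => Real.exp (t * |x|) * w x) μ)
    (hν : ∀ n : ℕ, Integrable (fun x => x ^ n) ν)
    (h : ∀ n : ℕ, ∫ x, x ^ n * w x ∂μ = ∫ x, x ^ n ∂ν) (t : ℝ) :
    Integrable (fun x => Real.exp (t * |x|)) ν := by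
  have hs : Summable fun k : ℕ => ∫ x, (t * x) ^ (2 * k) / ((2 * k)! : ℝ) ∂ν := by
    have := (hasSum_integral_pow_div_factorial_mul hwm (t : ℂ) (hw _)).summable
    have hre : Summable fun k : ℕ => t ^ k / (k ! : ℝ) * ∫ x, x ^ k * w x ∂μ := by
      rw [← Complex.summable_ofReal]
      exact_mod_cast this
    refine (hre.comp_injective (mul_right_injective₀ (two_ne_zero' ℕ))).congr fun k => ?_
    simp only [Function.comp_apply]
    rw [h, ← integral_const_mul]
    congr 1 with x
    ring
  -- The cosh series has only even powers, so its terms are nonnegative and Tonelli applies before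
  -- any integrability is known.
  have hcosh : Integrable (fun x => Real.cosh (t * x)) ν := by
    refine ⟨by fun_prop, ?_⟩
    rw [hasFiniteIntegral_iff_ofReal (.of_forall fun x => (Real.cosh_pos _).le)]
    have hnn : ∀ (k : ℕ) (x : ℝ), 0 ≤ (t * x) ^ (2 * k) / ((2 * k)! : ℝ) := fun k x => by
      rw [pow_mul]; positivity
    have : ∀ x, ENNReal.ofReal (Real.cosh (t * x)) =
        ∑' k : ℕ, ENNReal.ofReal ((t * x) ^ (2 * k) / ((2 * k)! : ℝ)) := fun x => by
      rw [← (Real.hasSum_cosh (t * x)).tsum_eq,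
        ENNReal.ofReal_tsum_of_nonneg (hnn · x) (Real.hasSum_cosh _).summable]
    simp_rw [this]
    rw [lintegral_tsum fun k => by fun_prop]
    have hterm : ∀ k : ℕ, ∫⁻ x, ENNReal.ofReal ((t * x) ^ (2 * k) / ((2 * k)! : ℝ)) ∂ν =
        ENNReal.ofReal (∫ x, (t * x) ^ (2 * k) / ((2 * k)! : ℝ) ∂ν) := fun k => by
      rw [ofReal_integral_eq_lintegral_ofReal _ (.of_forall (hnn k))]
      simp only [mul_pow]
      exact ((hν _).const_mul _).div_const _
    simp_rw [hterm]
    rw [← ENNReal.ofReal_tsum_of_nonneg (fun k => integral_nonneg (hnn k)) hs]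
    exact ENNReal.ofReal_lt_top
  refine (hcosh.const_mul 2).mono' (by fun_prop) (.of_forall fun x => ?_)
  rw [Real.norm_of_nonneg (Real.exp_pos _).le, Real.cosh_eq]
  have h1 := Real.exp_pos (t * x)
  have h2 := Real.exp_pos (-(t * x))
  rcases abs_choice x with hx | hx <;> rw [hx] <;> [skip; rw [mul_neg]] <;> linarith

/-- The positive part appears because `ENNReal.ofReal` truncates at zero. -/
theorem charFun_withDensity_ofReal {μ : Measure ℝ} {f : ℝ → ℝ} (hf : Measurable f) (t : ℝ) :
    charFun (μ.withDensity fun x => ENNReal.ofReal (f x)) t =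
      ∫ x, Complex.exp (t * x * Complex.I) * (max (f x) 0 : ℝ) ∂μ := by
  rw [charFun_apply_real, integral_withDensity_eq_integral_toReal_smul (by fun_prop) (by simp)]
  simp [ENNReal.toReal_ofReal', mul_comm]

/-- A finite measure with the Fourier transform of `g • μ` equals `g • μ`. -/
theorem eq_withDensity_of_charFun_eq {μ ν : Measure ℝ} [SigmaFinite μ] [IsFiniteMeasure ν]
    {g : ℝ → ℝ} (hgm : Measurable g) (hg : Integrable g μ)
    (h : ∀ t : ℝ, charFun ν t = ∫ x, Complex.exp (t * x * Complex.I) * g x ∂μ) :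
    (∀ᵐ x ∂μ, 0 ≤ g x) ∧ ν = μ.withDensity fun x => ENNReal.ofReal (g x) := by
  have hfin : ∀ f : ℝ → ℝ, Integrable f μ →
      IsFiniteMeasure (μ.withDensity fun x => ENNReal.ofReal (f x)) := fun f hf =>
    isFiniteMeasure_withDensity_ofReal hf.2
  have := hfin g hg
  have := hfin (fun x => -g x) hg.neg
  have hint : ∀ f : ℝ → ℝ, Integrable f μ → ∀ t : ℝ,
      Integrable (fun x : ℝ => Complex.exp (t * x * Complex.I) * f x) μ := fun f hf t => by
    refine hf.ofReal.bdd_mul (c := 1) (by fun_prop) (.of_forall fun x => ?_)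
    rw [← Complex.ofReal_mul, Complex.norm_exp_ofReal_mul_I]
  -- The sign of g is still unknown; moving its negative part to the left leaves two finite positive
  -- measures to compare.
  have hadd : ν + μ.withDensity (fun x => ENNReal.ofReal (-g x)) =
      μ.withDensity fun x => ENNReal.ofReal (g x) := by
    refine Measure.ext_of_charFun (funext fun t => ?_)
    rw [charFun_apply_real, integral_add_measure, ← charFun_apply_real, ← charFun_apply_real,
      charFun_withDensity_ofReal hgm.fun_neg, charFun_withDensity_ofReal hgm, h,
      ← integral_add (hint g hg t) (hint (fun x => max (-g x) 0) hg.neg.pos_part t)]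
    · congr 1 with x
      rw [← mul_add, ← Complex.ofReal_add]
      congr 2
      rcases le_total 0 (g x) with hx | hx
      · rw [max_eq_right (by linarith), max_eq_left hx, add_zero]
      · rw [max_eq_left (by linarith), max_eq_right hx, add_neg_cancel]
    all_goals
      refine (integrable_const (1 : ℝ)).mono' (by fun_prop) (.of_forall fun x => ?_)
      rw [← Complex.ofReal_mul, Complex.norm_exp_ofReal_mul_I]
  -- The right side of `hadd` does not charge {g < 0}, so neither does the negative part.
  have hneg : ∀ᵐ x ∂μ, 0 ≤ g x := by
    have hS : MeasurableSet {x | g x < 0} := measurableSet_lt hgm measurable_const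
    have h0 : (μ.withDensity fun x => ENNReal.ofReal (g x)) {x | g x < 0} = 0 := by
      rw [withDensity_apply _ hS, setLIntegral_eq_zero_iff hS (by fun_prop)]
      exact .of_forall fun x hx => ENNReal.ofReal_of_nonpos (le_of_lt hx)
    rw [← hadd, Measure.add_apply, add_eq_zero, withDensity_apply _ hS,
      setLIntegral_eq_zero_iff hS (by fun_prop)] at h0
    filter_upwards [h0.2] with x hx
    by_contra hlt
    rw [not_le] at hlt
    have := ENNReal.ofReal_eq_zero.1 (hx hlt)
    linarith
  refine ⟨hneg, ?_⟩
  rw [← hadd, withDensity_congr_ae (g := 0), withDensity_zero, add_zero]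
  filter_upwards [hneg] with x hx
  simp [hx]

/-! ### Pearson distance and Lebesgue densities. -/

theorem toReal_rnDeriv_withDensity_gaussianReal {g : ℝ → ℝ} (hg : Measurable g)
    (h0 : ∀ᵐ x ∂(gaussianReal 0 1), 0 ≤ g x) :
    (fun x => (((gaussianReal 0 1).withDensity
      fun x => ENNReal.ofReal (g x)).rnDeriv volume x).toReal) =ᵐ[volume]
      fun x => gaussianPDFReal 0 1 x * g x := by
  have h := Measure.rnDeriv_withDensity (volume : Measure ℝ)
    (f := gaussianPDF 0 1 * fun x => ENNReal.ofReal (g x))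
    ((measurable_gaussianPDF 0 1).mul hg.ennreal_ofReal)
  rw [withDensity_mul _ (measurable_gaussianPDF 0 1) hg.ennreal_ofReal,
    ← gaussianReal_of_var_ne_zero _ one_ne_zero] at h
  filter_upwards [h, (gaussianReal_absolutelyContinuous' 0 one_ne_zero).ae_le h0] with x hx hx0
  rw [hx]
  simp [toReal_gaussianPDF, ENNReal.toReal_ofReal hx0]

/-- With p = φg, the integrand (p - φ)²/φ becomes φ(g - 1)². -/
theorem chiSqNormal_withDensity_gaussianReal {g : ℝ → ℝ} (hg : Measurable g)
    (h0 : ∀ᵐ x ∂(gaussianReal 0 1), 0 ≤ g x) :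
    chiSqNormal ((gaussianReal 0 1).withDensity fun x => ENNReal.ofReal (g x)) =
      ∫⁻ x, ENNReal.ofReal ((g x - 1) ^ 2) ∂(gaussianReal 0 1) := by
  have hac : (gaussianReal 0 1).withDensity (fun x => ENNReal.ofReal (g x)) ≪ volume :=
    (withDensity_absolutelyContinuous _ _).trans (gaussianReal_absolutelyContinuous 0 one_ne_zero)
  rw [chiSqNormal, if_pos hac, gaussianReal_of_var_ne_zero _ one_ne_zero,
    lintegral_withDensity_eq_lintegral_mul _ (measurable_gaussianPDF 0 1) (by fun_prop),
    ← gaussianReal_of_var_ne_zero _ one_ne_zero]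
  refine lintegral_congr_ae ?_
  filter_upwards [toReal_rnDeriv_withDensity_gaussianReal hg h0] with x hx
  have hpos : 0 < gaussianPDFReal 0 1 x := gaussianPDFReal_pos 0 1 x one_ne_zero
  rw [hx, Pi.mul_apply, gaussianPDF, ← ENNReal.ofReal_mul hpos.le]
  congr 1
  field_simp

/-- A finite law whose moments are those of an `L²` weight times the standard normal law is that
weighted law. -/
theorem eq_withDensity_gaussianReal_of_integral_pow_eq {ν : Measure ℝ} [IsFiniteMeasure ν]
    {g : ℝ → ℝ} (hgm : Measurable g) (hg : MemLp g 2 (gaussianReal 0 1))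
    (hν : ∀ n : ℕ, Integrable (fun x => x ^ n) ν)
    (h : ∀ n : ℕ, ∫ x, x ^ n * g x ∂(gaussianReal 0 1) = ∫ x, x ^ n ∂ν) :
    (∀ᵐ x ∂(gaussianReal 0 1), 0 ≤ g x) ∧
      ν = (gaussianReal 0 1).withDensity fun x => ENNReal.ofReal (g x) := by
  refine eq_withDensity_of_charFun_eq hgm (hg.integrable (by norm_num)) fun t => ?_
  have h1 := hasSum_integral_pow_div_factorial_mul hgm (t * Complex.I)
    (integrable_exp_mul_abs_mul_gaussianReal hg _)
  have h2 := hasSum_integral_pow_div_factorial_mul (μ := ν) (w := fun _ => 1) measurable_const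
    (t * Complex.I) (by
      simpa using integrable_exp_mul_abs_of_integral_pow_eq hgm
        (integrable_exp_mul_abs_mul_gaussianReal hg) hν h _)
  simp only [mul_one] at h2
  simp only [h] at h1
  rw [charFun_apply_real]
  simpa [mul_right_comm] using h2.unique h1

theorem chiSqNormal_eq_of_summable {ν : Measure ℝ} [IsProbabilityMeasure ν]
    (hν : ∀ n : ℕ, Integrable (fun x => x ^ n) ν)
    (hs : Summable fun k => (∫ x, (hermiteReal (k + 1)).eval x ∂ν) ^ 2 / ((k + 1)! : ℝ)) :
    ν ≪ volume ∧ chiSqNormal ν = ENNReal.ofReal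
      (∑' k, (∫ x, (hermiteReal (k + 1)).eval x ∂ν) ^ 2 / ((k + 1)! : ℝ)) := by
  obtain ⟨g, hgm, hg, hmom, hsq⟩ := exists_memLp_integral_hermiteReal_mul_eq
    (m := fun k => ∫ x, (hermiteReal k).eval x ∂ν) (by simp [hermiteReal_zero]) hs
  have hpow : ∀ n : ℕ, ∫ x, x ^ n * g x ∂(gaussianReal 0 1) = ∫ x, x ^ n ∂ν := fun n => by
    simpa using integral_pow_mul_eq_of_integral_hermiteReal_mul_eq
      (fun n => (memLp_pow_gaussianReal n).integrable_mul hg)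
      (z := fun _ => 1) (by simpa using hν) (by simpa using hmom) n
  obtain ⟨h0, hν⟩ := eq_withDensity_gaussianReal_of_integral_pow_eq hgm hg hν hpow
  rw [← hsq]
  refine ⟨hν ▸ (withDensity_absolutelyContinuous _ _).trans
    (gaussianReal_absolutelyContinuous 0 one_ne_zero), ?_⟩
  conv_lhs => rw [hν]
  rw [chiSqNormal_withDensity_gaussianReal hgm h0]
  exact (ofReal_integral_eq_lintegral_ofReal (hg.sub (memLp_const 1)).integrable_sq
    (.of_forall fun x => sq_nonneg _)).symm

theorem gaussianPDFReal_le_one (x : ℝ) : gaussianPDFReal 0 1 x ≤ 1 := by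
  rw [gaussianPDFReal_def]
  refine mul_le_one₀ (inv_le_one_of_one_le₀ ?_) (Real.exp_pos _).le
    (Real.exp_le_one_iff.2 ?_)
  · rw [Real.one_le_sqrt, NNReal.coe_one]
    linarith [Real.pi_gt_three]
  · rw [neg_div]
    exact neg_nonpos.2 (by positivity)

/-- Since 0 < φ ≤ 1, (p - φ)² ≤ (p - φ)²/φ; and φ itself is in L². -/
theorem memLp_two_rnDeriv_of_chiSqNormal_lt_top {ν : Measure ℝ} (h : chiSqNormal ν < ∞) :
    MemLp (fun x => (ν.rnDeriv volume x).toReal) 2 volume := by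
  rw [chiSqNormal] at h
  split_ifs at h
  · have hφ : MemLp (gaussianPDFReal 0 1) 2 volume := by
      rw [memLp_two_iff_integrable_sq (by fun_prop)]
      refine (integrable_gaussianPDFReal 0 1).mono' (by fun_prop) (.of_forall fun x => ?_)
      have := gaussianPDFReal_nonneg 0 1 x
      rw [Real.norm_of_nonneg (sq_nonneg _)]
      nlinarith [gaussianPDFReal_le_one x]
    have hpm : Measurable fun x => (ν.rnDeriv volume x).toReal :=
      (Measure.measurable_rnDeriv _ _).ennreal_toReal
    have hdiff : MemLp (fun x => (ν.rnDeriv volume x).toReal - gaussianPDFReal 0 1 x) 2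
        volume := by
      rw [memLp_two_iff_integrable_sq (by fun_prop)]
      have hint : Integrable fun x => ((ν.rnDeriv volume x).toReal - gaussianPDFReal 0 1 x) ^ 2 /
          gaussianPDFReal 0 1 x := by
        refine ⟨Measurable.aestronglyMeasurable (by fun_prop), ?_⟩
        rwa [hasFiniteIntegral_iff_ofReal
          (.of_forall fun x => div_nonneg (sq_nonneg _) (gaussianPDFReal_nonneg 0 1 x))]
      refine hint.mono' (by fun_prop) (.of_forall fun x => ?_)
      rw [Real.norm_of_nonneg (sq_nonneg _)]
      exact le_div_self (sq_nonneg _) (gaussianPDFReal_pos 0 1 x one_ne_zero)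
        (gaussianPDFReal_le_one x)
    exact (hdiff.add hφ).ae_eq (.of_forall fun x => sub_add_cancel _ _)
  · simp at h

/-- Bessel's inequality for the Hermite coefficients of a boundedly supported `L²` density. -/
theorem summable_sq_integral_hermiteReal {ν : Measure ℝ} [IsFiniteMeasure ν] {M : ℝ}
    (hM : ∀ᵐ x ∂ν, |x| ≤ M) (hac : ν ≪ volume)
    (hL : MemLp (fun x => (ν.rnDeriv volume x).toReal) 2 volume) :
    Summable fun k => (∫ x, (hermiteReal k).eval x ∂ν) ^ 2 / (k ! : ℝ) := by
  set p : ℝ → ℝ := fun x => (ν.rnDeriv volume x).toReal with hp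
  have hpm : Measurable p := (Measure.measurable_rnDeriv _ _).ennreal_toReal
  have hφpos := fun x => gaussianPDFReal_pos 0 1 x one_ne_zero
  have hsupp : ∀ᵐ x, M < |x| → p x = 0 := by
    have hS : MeasurableSet {x : ℝ | M < |x|} :=
      measurableSet_lt measurable_const continuous_abs.measurable
    have hν0 : ν {x : ℝ | M < |x|} = 0 := by
      simpa [ae_iff] using hM
    rw [← Measure.setLIntegral_rnDeriv hac, setLIntegral_eq_zero_iff hS
      (Measure.measurable_rnDeriv _ _)] at hν0
    filter_upwards [hν0] with x hx hxM
    simp [hp, hx hxM]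
  have hf : MemLp (fun x => p x / gaussianPDFReal 0 1 x) 2 (gaussianReal 0 1) := by
    rw [memLp_two_iff_integrable_sq (Measurable.aestronglyMeasurable (by fun_prop)),
      integrable_gaussianReal_iff]
    -- φ decreases in |x|, so 1/φ ≤ 1/φ(M) where |x| ≤ M; elsewhere p = 0.
    refine (hL.integrable_sq.const_mul (gaussianPDFReal 0 1 M)⁻¹).mono' (by fun_prop) ?_
    filter_upwards [hsupp] with x hx
    rw [Real.norm_of_nonneg (mul_nonneg (hφpos x).le (sq_nonneg _))]
    have heq : gaussianPDFReal 0 1 x * (p x / gaussianPDFReal 0 1 x) ^ 2 =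
        (gaussianPDFReal 0 1 x)⁻¹ * p x ^ 2 := by
      have := (hφpos x).ne'
      field_simp
    rw [heq]
    rcases lt_or_ge M |x| with h | h
    · simp [hx h]
    · refine mul_le_mul_of_nonneg_right (inv_anti₀ (hφpos M) ?_) (sq_nonneg _)
      simp only [gaussianPDFReal_def]
      have : x ^ 2 ≤ M ^ 2 := sq_le_sq' (abs_le.1 h).1 (abs_le.1 h).2
      refine mul_le_mul_of_nonneg_left (Real.exp_le_exp.2 ?_) (by positivity)
      rw [NNReal.coe_one, sub_zero, sub_zero]
      linarith
  refine (orthonormal_hermiteLp.inner_products_summable hf.toLp).congr fun k => ?_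
  rw [inner_hermiteLp, Real.norm_eq_abs, sq_abs, mul_pow, inv_pow,
    Real.sq_sqrt (by positivity), inv_mul_eq_div, ← integral_rnDeriv_smul hac,
    integral_gaussianReal_eq_integral_smul one_ne_zero]
  congr 3 with x
  have := (hφpos x).ne'
  simp only [smul_eq_mul, hp]
  field_simp

theorem proposition8p3 {Ω : Type*} [MeasurableSpace Ω] (P : Measure Ω) [IsProbabilityMeasure P]
    (X : Ω → ℝ) (hX : AEMeasurable X P) :
    ((∀ k : ℕ, Integrable (fun ω => |X ω| ^ k) P) →
      Summable (fun k : ℕ => normalMoment P X (k + 1) ^ 2 / ((k + 1)! : ℝ)) →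
        P.map X ≪ volume ∧
        chiSqNormal (P.map X) < ∞ ∧
        chiSqNormal (P.map X) =
          ENNReal.ofReal (∑' k : ℕ, normalMoment P X (k + 1) ^ 2 / ((k + 1)! : ℝ))) ∧
    ((∃ M : ℝ, ∀ᵐ ω ∂P, |X ω| ≤ M) →
      ((P.map X ≪ volume ∧ MemLp (fun x => ((P.map X).rnDeriv volume x).toReal) 2 volume) ↔
        Summable (fun k : ℕ => normalMoment P X (k + 1) ^ 2 / ((k + 1)! : ℝ)))) := by
  have : IsProbabilityMeasure (P.map X) := Measure.isProbabilityMeasure_map hX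
  have hmom : ∀ k, normalMoment P X k = ∫ x, (hermiteReal k).eval x ∂(P.map X) := fun k => by
    rw [integral_map hX (Polynomial.continuous _).aestronglyMeasurable, normalMoment]
    simp only [eval_hermiteReal]
  have hpow : (∀ k : ℕ, Integrable (fun ω => |X ω| ^ k) P) →
      ∀ n : ℕ, Integrable (fun x => x ^ n) (P.map X) := fun h n => by
    rw [integrable_map_measure (by fun_prop) hX]
    exact (h n).mono' (hX.pow_const n).aestronglyMeasurable (.of_forall fun ω => by simp)
  simp only [hmom]
  refine ⟨fun hint hs => ?_, fun ⟨M, hM⟩ => ⟨fun ⟨hac, hL⟩ => ?_, fun hs => ?_⟩⟩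
  · obtain ⟨hac, heq⟩ := chiSqNormal_eq_of_summable (hpow hint) hs
    exact ⟨hac, heq ▸ ENNReal.ofReal_lt_top, heq⟩
  · have hM' : ∀ᵐ x ∂(P.map X), |x| ≤ M :=
      (ae_map_iff hX (measurableSet_le continuous_abs.measurable measurable_const)).2 hM
    exact (summable_nat_add_iff 1).2 (summable_sq_integral_hermiteReal hM' hac hL)
  · have hint : ∀ k : ℕ, Integrable (fun ω => |X ω| ^ k) P := fun k => by
      refine (integrable_const (M ^ k)).mono' (by fun_prop) ?_
      filter_upwards [hM] with ω hω
      rw [Real.norm_of_nonneg (by positivity)]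
      exact pow_le_pow_left₀ (abs_nonneg _) hω k
    obtain ⟨hac, heq⟩ := chiSqNormal_eq_of_summable (hpow hint) hs
    exact ⟨hac, memLp_two_rnDeriv_of_chiSqNormal_lt_top (heq ▸ ENNReal.ofReal_lt_top)⟩
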